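/- **Setting.** Let $\mathbb R_n$ be the real Clifford algebra generated by $e_1,\dots,e_n$ with $e_ie_j+e_je_i=-2\delta_{ij}$, with the Euclidean norm $|\sum_A a_Ae_A|^2=\sum_A a_A^2$ with respect to the basis $e_A=e_{i_1}\cdots e_{i_r}$, $A=\{i_1<\dots<i_r\}$. Identify $x=(x_0,\dots,x_n)\in\mathbb R^{n+1}$ with the paravector $x_0+x_1e_1+\dots+x_ne_n$. A $C^1$ function $f:\mathbb R^{n+1}\to\mathbb R_n$ is (entire) left monogenic if $\partial_{x_0}f+\sum_{i=1}^n e_i\,\partial_{x_i}f=0$. For $\sigma>0$ let $A_{1,\sigma}$ be the space of entire left monogenic $f$ with $\|f\|_{1,\sigma}:=\sup_{x\in\mathbb R^{n+1}}|f(x)|e^{-\sigma|x|}<\infty$. A sequence $(f_N)$ converges to $f$ in $A_1$ if for some $\sigma>0$ one has $f\in A_{1,\sigma}$, $f_N\in A_{1,\sigma}$ for all $N$, and $\|f_N-f\|_{1,\sigma}\to0$. For a multi-index $m\in\mathbb N_0^n$ with $|m|=m_1+\dots+m_n=k$ and $m!=m_1!\cdots m_n!$, let $\Pi(m)$ be the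 set of sequences $(\ell_1,\dots,\ell_k)\in\{1,\dots,n\}^k$ in which each $i$ occurs exactly $m_i$ times, put $z_i=x_i-x_0e_i$, and define $$P_m(x)=\frac{m!}{k!}\sum_{\ell\in\Pi(m)}z_{\ell_1}\cdots z_{\ell_k},\qquad e'_m=\sum_{\ell\in\Pi(m)}e_{\ell_1}\cdots e_{\ell_k}$$ (empty products being $1$). The monogenic exponential, that is, the left monogenic (Cauchy–Kowalewski) extension of $e^{x_1e_1+\dots+x_ne_n}$ to $\mathbb R^{n+1}$, is $$E(x)=\sum_{k=0}^\infty\frac1{k!}\sum_{|m|=k}P_m(x)\,e'_m .$$ **Theorem.** Let $u_\ell:\mathbb R^{n+1}\to\mathbb R^{n+1}$, $\ell=0,1,2,\dots$, be functions, each bounded on every compact set (for example continuous), such that for every compact $K\subset\mathbb R^{n+1}$ $$\limsup_{\ell\to\infty}\ \sup_{x\in K}|u_\ell(x)|^{1/\ell}=0 .$$ Let $a\in\mathbb R$, and for $N\in\mathbb N$, $0\le j\le N$, let $h_j(N)\in[-1,1]$ and $Z_j(N,a)\in\mathbb R_n$ be such that $$f_N(x)=\sum_{j=0}^N E(h_j(N)x)\,Z_j(N,a)$$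 converges to $x\mapsto E(ax)$ in $A_1$ as $N\to\infty$. Then the series $\sum_{\ell=0}^\infty u_\ell(x)t^\ell$ converges absolutely for all $x\in\mathbb R^{n+1}$, $t\in\mathbb R$, and $$\lim_{N\to\infty}\ \sum_{j=0}^N Z_j(N,a)\,E\Big(\sum_{\ell=0}^\infty u_\ell(x)h_j(N)^\ell\Big)=E\Big(\sum_{\ell=0}^\infty u_\ell(x)a^\ell\Big)$$ uniformly on every compact subset of $\mathbb R^{n+1}$. -/

import Mathlib

open Filter Topology

namespace Monogenic

noncomputable section

/-- The negative definite quadratic form `v ↦ -(v₁² + ⋯ + vₙ²)` on `ℝⁿ`. -/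
def negForm (n : ℕ) : QuadraticForm ℝ (Fin n → ℝ) :=
  QuadraticMap.weightedSumSquares ℝ (fun _ : Fin n => (-1 : ℝ))

/-- The real Clifford algebra `ℝₙ` over `n` imaginary units. -/
abbrev Cl (n : ℕ) : Type := CliffordAlgebra (negForm n)

/-- The imaginary units `e₁, …, eₙ` of `ℝₙ` (indexed by `Fin n`). -/
def e {n : ℕ} (i : Fin n) : Cl n := CliffordAlgebra.ι (negForm n) (Pi.single i 1)

theorem negForm_polar {n : ℕ} {i j : Fin n} (h : i ≠ j) :
    QuadraticMap.polar (negForm n) (Pi.single i 1) (Pi.single j 1) = 0 := by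
  simp only [QuadraticMap.polar, negForm, QuadraticMap.weightedSumSquares_apply,
    ← Finset.sum_sub_distrib]
  refine Finset.sum_eq_zero fun k _ => ?_
  by_cases hi : k = i
  · subst hi; simp [h]
  · simp [Pi.single_apply, hi]

theorem e_mul_self {n : ℕ} (i : Fin n) : e i * e i = (-1 : Cl n) := by
  have : negForm n (Pi.single i 1) = -1 := by simp [negForm, Pi.single_apply]
  rw [e, CliffordAlgebra.ι_sq_scalar, this, map_neg, map_one]

theorem e_mul_e_of_ne {n : ℕ} {i j : Fin n} (h : i ≠ j) : e i * e j = -(e j * e i : Cl n) := by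
  rw [eq_neg_iff_add_eq_zero, e, e, CliffordAlgebra.ι_mul_ι_add_swap, negForm_polar h, map_zero]

/-- `e_A = e_{i₁} ⋯ e_{iᵣ}` for `A = {i₁ < ⋯ < iᵣ}`, with `e_∅ = 1`. -/
def blade {n : ℕ} (A : Finset (Fin n)) : Cl n := ((A.sort (· ≤ ·)).map e).prod

theorem contractLeft_prod_eq_zero {n : ℕ} {Q : QuadraticForm ℝ (Fin n → ℝ)}
    (d : Module.Dual ℝ (Fin n → ℝ)) (l : List (Fin n))
    (hl : ∀ j ∈ l, d (Pi.single j 1) = 0) :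
    CliffordAlgebra.contractLeft d
      (l.map fun j => CliffordAlgebra.ι Q (Pi.single j 1)).prod = 0 := by
  induction l with
  | nil => simp [CliffordAlgebra.contractLeft_one]
  | cons a l ih =>
    rw [List.map_cons, List.prod_cons, CliffordAlgebra.contractLeft_ι_mul,
      hl a (by simp), ih fun j hj => hl j (by simp [hj])]
    simp

theorem changeForm_prod {n : ℕ} {Q Q' : QuadraticForm ℝ (Fin n → ℝ)}
    {B : LinearMap.BilinForm ℝ (Fin n → ℝ)} (h : B.toQuadraticMap = Q' - Q)
    (hB : ∀ i j : Fin n, i ≠ j → B (Pi.single i 1) (Pi.single j 1) = 0)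
    (l : List (Fin n)) (hl : l.Nodup) :
    CliffordAlgebra.changeForm h (l.map fun j => CliffordAlgebra.ι Q (Pi.single j 1)).prod =
      (l.map fun j => CliffordAlgebra.ι Q' (Pi.single j 1)).prod := by
  induction l with
  | nil => simp
  | cons a l ih =>
    rw [List.nodup_cons] at hl
    rw [List.map_cons, List.prod_cons, CliffordAlgebra.changeForm_ι_mul, ih hl.2,
      contractLeft_prod_eq_zero _ l fun j hj => hB a j (by rintro rfl; exact hl.1 hj)]
    simp

theorem negForm_associated (n : ℕ) [Invertible (2 : ℝ)] {i j : Fin n} (h : i ≠ j) :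
    QuadraticMap.associated (R := ℝ) (-(negForm n)) (Pi.single i 1) (Pi.single j 1) = 0 := by
  rw [QuadraticMap.associated_apply]
  have := negForm_polar h
  rw [QuadraticMap.polar] at this
  have h2 : (-(negForm n)) (Pi.single i 1 + Pi.single j 1) - (-(negForm n)) (Pi.single i 1) -
      (-(negForm n)) (Pi.single j 1) = 0 := by
    simp only [neg_apply]
    linarith
  rw [h2, smul_zero]

/-- The basis `(e_A)_A` of `ℝₙ`, indexed by the subsets `A` of `{1, …, n}`
(see `cliffordBasis_apply`). -/
def cliffordBasis (n : ℕ) : Module.Basis (Finset (Fin n)) ℝ (Cl n) :=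
  letI : Invertible (2 : ℝ) := invertibleOfNonzero two_ne_zero
  (Pi.basisFun ℝ (Fin n)).ExteriorAlgebra.map (CliffordAlgebra.equivExterior (negForm n)).symm

theorem cliffordBasis_apply {n : ℕ} (A : Finset (Fin n)) : cliffordBasis n A = blade A := by
  let _ : Invertible (2 : ℝ) := invertibleOfNonzero two_ne_zero
  have h1 : (Pi.basisFun ℝ (Fin n)).ExteriorAlgebra A =
      ((A.sort (· ≤ ·)).map fun j => CliffordAlgebra.ι (0 : QuadraticForm ℝ (Fin n → ℝ))
        (Pi.single j 1)).prod := by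
    rw [ExteriorAlgebra.basis_apply_ofCard _ rfl, ExteriorAlgebra.ιMulti_family,
      ExteriorAlgebra.ιMulti_apply]
    congr 1
    refine List.ext_getElem (by simp) fun k hk hk' => ?_
    simp [Set.powersetCard.ofFinEmbEquiv_symm_apply, Set.powersetCard.ofCard]
    rfl
  have h2 : CliffordAlgebra.equivExterior (negForm n) (blade A) =
      ((A.sort (· ≤ ·)).map fun j => CliffordAlgebra.ι (0 : QuadraticForm ℝ (Fin n → ℝ))
        (Pi.single j 1)).prod :=
    changeForm_prod CliffordAlgebra.changeForm.associated_neg_proof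
      (fun i j hij => negForm_associated n hij) _ (Finset.sort_nodup _ _)
  have h3 : cliffordBasis n A = (CliffordAlgebra.equivExterior (negForm n)).symm
      ((Pi.basisFun ℝ (Fin n)).ExteriorAlgebra A) := by
    rw [cliffordBasis, Module.Basis.map_apply]
  rw [h3, h1, ← h2, LinearEquiv.symm_apply_apply]

/-- The coordinates `(a_A)_A` of a Clifford number `a = ∑_A a_A e_A`. -/
def coords (n : ℕ) : Cl n ≃ₗ[ℝ] EuclideanSpace ℝ (Finset (Fin n)) :=
  (cliffordBasis n).equivFun.trans (WithLp.linearEquiv 2 ℝ (Finset (Fin n) → ℝ)).symm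

/-- The Euclidean norm `|a|² = ∑_A |a_A|²` on `ℝₙ` (see `norm_sq_eq`). -/
instance instNormedAddCommGroupCl (n : ℕ) : NormedAddCommGroup (Cl n) :=
  NormedAddCommGroup.induced (Cl n) (EuclideanSpace ℝ (Finset (Fin n)))
    (coords n).toLinearMap (coords n).injective

instance instNormedSpaceCl (n : ℕ) : NormedSpace ℝ (Cl n) :=
  NormedSpace.induced ℝ (Cl n) (EuclideanSpace ℝ (Finset (Fin n))) (coords n).toLinearMap

theorem norm_sq_eq {n : ℕ} (a : Cl n) : ‖a‖ ^ 2 = ∑ A, ((cliffordBasis n).repr a A) ^ 2 := by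
  have : ‖a‖ = ‖coords n a‖ := rfl
  rw [this, EuclideanSpace.norm_sq_eq]
  simp [coords, Module.Basis.equivFun_apply]

/-- Points `x = (x₀, x₁, …, xₙ)` of `ℝⁿ⁺¹`, identified with the paravectors
`x₀ + x₁ e₁ + ⋯ + xₙ eₙ`; the norm is the Euclidean one. -/
abbrev Para (n : ℕ) : Type := EuclideanSpace ℝ (Fin (n + 1))

/-- `f : ℝⁿ⁺¹ → ℝₙ` is entire left monogenic: it is `C¹` and
`∂f/∂x₀ + ∑ᵢ eᵢ ∂f/∂xᵢ = 0` everywhere. -/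
def LeftMonogenic {n : ℕ} (f : Para n → Cl n) : Prop :=
  ContDiff ℝ 1 f ∧ ∀ x : Para n,
    fderiv ℝ f x (EuclideanSpace.single 0 1) +
      ∑ i : Fin n, e i * fderiv ℝ f x (EuclideanSpace.single i.succ 1) = 0

/-- `‖f‖_{1,σ} = sup_x |f(x)| e^{-σ|x|}`, as an extended nonnegative number. -/
def expNorm {n : ℕ} (σ : ℝ) (f : Para n → Cl n) : ENNReal :=
  ⨆ x : Para n, ENNReal.ofReal (‖f x‖ * Real.exp (-σ * ‖x‖))

/-- The space `A_{1,σ}` of entire left monogenic functions with `‖f‖_{1,σ} < ∞`. -/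
def A1 (n : ℕ) (σ : ℝ) : Set (Para n → Cl n) :=
  {f | LeftMonogenic f ∧ expNorm σ f < ⊤}

/-- Convergence of a sequence `(f_N)` to `f` in `A₁ = ⋃_σ A_{1,σ}`. -/
def ConvergesInA1 {n : ℕ} (f : ℕ → Para n → Cl n) (g : Para n → Cl n) : Prop :=
  ∃ σ : ℝ, 0 < σ ∧ g ∈ A1 n σ ∧ (∀ N, f N ∈ A1 n σ) ∧
    Tendsto (fun N => expNorm σ (f N - g)) atTop (𝓝 0)

/-- The Fueter variables `zᵢ = xᵢ - x₀ eᵢ`. -/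
def z {n : ℕ} (i : Fin n) (x : Para n) : Cl n :=
  algebraMap ℝ (Cl n) (x i.succ) - x 0 • e i

/-- The distinguishable permutations `(ℓ₁, …, ℓ_{|m|})` of the sequence in which every
index `i` appears exactly `mᵢ` times. -/
def arrangements {n : ℕ} (m : Fin n → ℕ) : Finset (Fin (∑ i, m i) → Fin n) :=
  {w | ∀ i, (Finset.univ.filter fun p => w p = i).card = m i}

/-- The Fueter polynomial
`P_m(x) = (m! / |m|!) ∑ z_{ℓ₁} ⋯ z_{ℓ_{|m|}}`, the sum being over the distinguishable permutations
of the sequence in which `i` appears `mᵢ` times. Each of them comes from exactly `m!` of the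
`|m|!` permutations, so this is the average of the products over all `|m|!` permutations. -/
def fueter {n : ℕ} (m : Fin n → ℕ) (x : Para n) : Cl n :=
  (((∏ i, (m i).factorial : ℕ) : ℝ) / ((∑ i, m i).factorial : ℝ)) •
    ∑ w ∈ arrangements m, (List.ofFn fun p => z (w p) x).prod

/-- `e'_m = ∑ e_{ℓ₁} ⋯ e_{ℓ_{|m|}}`, the sum being over the distinguishable permutations of the
sequence in which `i` appears `mᵢ` times. -/
def unitSum {n : ℕ} (m : Fin n → ℕ) : Cl n :=
  ∑ w ∈ arrangements m, (List.ofFn fun p => e (w p)).prod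

/-- The monogenic exponential `E(x) = ∑_k (1/k!) ∑_{|m|=k} P_m(x) e'_m`, that is, the
Cauchy-Kowalewski extension of `exp(x₁ e₁ + ⋯ + xₙ eₙ)`. -/
def E {n : ℕ} (x : Para n) : Cl n :=
  ∑' k : ℕ, ((k.factorial : ℝ)⁻¹) •
    ∑ m ∈ Finset.piAntidiag (Finset.univ : Finset (Fin n)) k, fueter m x * unitSum m

end

end Monogenic

namespace Monogenic

noncomputable section

/-! Everything passes through the moment errors `∑ⱼ hⱼ^k Zⱼ - a^k`. They are real powers times
Clifford numbers, so it does not matter that `Zⱼ` stands on the right of `E` in the hypothesis and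
on the left in the conclusion.

Convergence in `A₁` makes the moment errors small: `exists_moment_bound` gives `R ε C₀^k` with `C₀`,
`R` depending only on `n` and `σ`. On a coordinate axis `E` is `cos t + sin t eᵢ`, so the `k`-th
axial derivative at the origin of `f_N - E(a·)` is `eᵢ^k` times the moment error. By
`exists_fderiv_bound` each differentiation costs one fixed factor and keeps the same type `σ`. That
estimate rests on a mean value property, proved directly for `C¹` monogenic functions with a smooth
radial weight.

Conversely, the moments control the superoscillating sum. For fixed `x`, `g(t) = E(∑ u_ℓ(x) t^ℓ)`
expands into monomials `t^d b` with `∑ C^d |b| ≤ M`, uniformly for `x` in a compact set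
(`PowBound.exists_E`). Expanding termwise, `∑ⱼ Zⱼ g(hⱼ) - g(a)` is the sum of moment errors times
coefficients, hence `O(ε M)`. Since `C₀` depends on `σ` and may be large, the series must converge
for every `C`; this is what the root condition on `u_ℓ` supplies. -/

instance instFiniteDimensionalCl (n : ℕ) : FiniteDimensional ℝ (Cl n) :=
  (cliffordBasis n).finiteDimensional_of_finite

/-- The multiplication of `ℝₙ` as a continuous bilinear map. -/
def mulCLM (n : ℕ) : Cl n →L[ℝ] Cl n →L[ℝ] Cl n :=
  LinearMap.toContinuousLinearMap
    ((LinearMap.toContinuousLinearMap : (Cl n →ₗ[ℝ] Cl n) ≃ₗ[ℝ] (Cl n →L[ℝ] Cl n)).toLinearMap ∘ₗ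
      LinearMap.mul ℝ (Cl n))

@[simp] theorem mulCLM_apply {n : ℕ} (a b : Cl n) : mulCLM n a b = a * b := rfl

theorem norm_mul_le_mulCLM {n : ℕ} (a b : Cl n) : ‖a * b‖ ≤ ‖mulCLM n‖ * ‖a‖ * ‖b‖ :=
  (mulCLM n).le_opNorm₂ a b

/-! ### Functions with an absolutely convergent power series expansion -/

section PowBound

variable {V W X : Type*} [NormedAddCommGroup V] [NormedSpace ℝ V]
  [NormedAddCommGroup W] [NormedSpace ℝ W] [NormedAddCommGroup X] [NormedSpace ℝ X]

/-- On `[-C, C]` the function `g` is a sum of monomials `t ^ dᵢ • aᵢ`, indexed by an arbitrary type,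
with `∑ C ^ dᵢ ‖aᵢ‖ ≤ M`. -/
def PowBound (C : ℝ) (g : ℝ → V) (M : ℝ) : Prop :=
  ∃ (ι : Type) (d : ι → ℕ) (a : ι → V), Summable (fun i => C ^ d i * ‖a i‖) ∧
    ∑' i, C ^ d i * ‖a i‖ ≤ M ∧ ∀ t, |t| ≤ C → HasSum (fun i => t ^ d i • a i) (g t)

theorem norm_pow_smul_le {C t : ℝ} (ht : |t| ≤ C) (k : ℕ) (a : V) :
    ‖t ^ k • a‖ ≤ C ^ k * ‖a‖ := by
  rw [norm_smul, norm_pow, Real.norm_eq_abs]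
  gcongr

theorem PowBound.mono {C M N : ℝ} {g : ℝ → V} (h : PowBound C g M) (hMN : M ≤ N) :
    PowBound C g N := by
  obtain ⟨ι, d, a, h1, h2, h3⟩ := h
  exact ⟨ι, d, a, h1, h2.trans hMN, h3⟩

theorem PowBound.nonneg {C M : ℝ} {g : ℝ → V} (hC : 0 ≤ C) (h : PowBound C g M) : 0 ≤ M := by
  obtain ⟨ι, d, a, h1, h2, h3⟩ := h
  exact (tsum_nonneg fun i => by positivity).trans h2

theorem PowBound.const (C : ℝ) (v : V) : PowBound C (fun _ => v) ‖v‖ :=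
  ⟨Unit, fun _ => 0, fun _ => v, (hasSum_fintype _).summable, by simp, fun t _ => by
    simp⟩

theorem PowBound.clm {C M : ℝ} {g : ℝ → V} (hC : 0 ≤ C) (h : PowBound C g M) (L : V →L[ℝ] W) :
    PowBound C (fun t => L (g t)) (‖L‖ * M) := by
  obtain ⟨ι, d, a, h1, h2, h3⟩ := h
  have hle : ∀ i, C ^ d i * ‖L (a i)‖ ≤ ‖L‖ * (C ^ d i * ‖a i‖) := fun i => by
    calc C ^ d i * ‖L (a i)‖ ≤ C ^ d i * (‖L‖ * ‖a i‖) := by gcongr; exact L.le_opNorm _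
      _ = _ := by ring
  have hs : Summable fun i => C ^ d i * ‖L (a i)‖ :=
    Summable.of_nonneg_of_le (fun i => by positivity) hle (h1.mul_left _)
  refine ⟨ι, d, fun i => L (a i), hs, ?_, fun t ht => ?_⟩
  · refine (hs.tsum_le_tsum hle (h1.mul_left _)).trans ?_
    rw [tsum_mul_left]
    gcongr
  · simpa using (h3 t ht).mapL L

/-- A Cauchy product without regrouping by degree: the monomials are indexed by pairs, which is why
the index type in `PowBound` is left arbitrary. -/
theorem PowBound.bilin [CompleteSpace X] {C M N : ℝ} {f : ℝ → V} {g : ℝ → W} (hC : 0 ≤ C) (hf : PowBound C f M)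
    (hg : PowBound C g N) (L : V →L[ℝ] W →L[ℝ] X) :
    PowBound C (fun t => L (f t) (g t)) (‖L‖ * M * N) := by
  have hM := hf.nonneg hC
  obtain ⟨ι, d, a, h1, h2, h3⟩ := hf
  obtain ⟨κ, e, b, k1, k2, k3⟩ := hg
  have hprod : Summable fun p : ι × κ => (C ^ d p.1 * ‖a p.1‖) * (C ^ e p.2 * ‖b p.2‖) :=
    h1.mul_of_nonneg k1 (fun i => by positivity) (fun i => by positivity)
  have hle : ∀ p : ι × κ, C ^ (d p.1 + e p.2) * ‖L (a p.1) (b p.2)‖ ≤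
      ‖L‖ * ((C ^ d p.1 * ‖a p.1‖) * (C ^ e p.2 * ‖b p.2‖)) := fun p => by
    calc C ^ (d p.1 + e p.2) * ‖L (a p.1) (b p.2)‖
        ≤ C ^ (d p.1 + e p.2) * (‖L‖ * ‖a p.1‖ * ‖b p.2‖) := by
          gcongr; exact L.le_opNorm₂ _ _
      _ = _ := by ring
  have hs : Summable fun p : ι × κ => C ^ (d p.1 + e p.2) * ‖L (a p.1) (b p.2)‖ :=
    Summable.of_nonneg_of_le (fun i => by positivity) hle (hprod.mul_left _)
  refine ⟨ι × κ, fun p => d p.1 + e p.2, fun p => L (a p.1) (b p.2), hs, ?_, fun t ht => ?_⟩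
  · refine (hs.tsum_le_tsum hle (hprod.mul_left _)).trans ?_
    rw [tsum_mul_left, ← h1.tsum_mul_tsum k1 hprod, mul_assoc]
    gcongr
  · have hs' : Summable fun p : ι × κ => t ^ (d p.1 + e p.2) • L (a p.1) (b p.2) :=
      Summable.of_norm_bounded hs fun p => norm_pow_smul_le ht _ _
    -- Summing over the second index first gives `L (t^d • a) (g t)`. The sum of these over the
    -- first index is `L (f t) (g t)`, by uniqueness of sums.
    have hfib := hs'.hasSum.prod_fiberwise (g := fun i => L (t ^ d i • a i) (g t)) fun i => by
      refine ((k3 t ht).mapL (L (t ^ d i • a i))).congr_fun ?_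
      intro j
      simp [pow_add, smul_smul, mul_comm]
    have := (h3 t ht).mapL (L.flip (g t))
    simp only [ContinuousLinearMap.flip_apply] at this
    beta_reduce
    rw [this.unique hfib]
    exact hs'.hasSum

theorem PowBound.tsum [CompleteSpace V] {κ : Type} {C : ℝ} {f : κ → ℝ → V} {M : κ → ℝ} (hC : 0 ≤ C)
    (hf : ∀ k, PowBound C (f k) (M k)) (hM : Summable M) :
    PowBound C (fun t => ∑' k, f k t) (∑' k, M k) := by
  choose ι d a h1 h2 h3 using hf
  have hs1 : Summable fun k => ∑' i, C ^ d k i * ‖a k i‖ :=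
    Summable.of_nonneg_of_le (fun k => tsum_nonneg fun i => by positivity) h2 hM
  have hs : Summable fun p : Σ k, ι k => C ^ d p.1 p.2 * ‖a p.1 p.2‖ :=
    (summable_sigma_of_nonneg fun p => by positivity).2 ⟨h1, hs1⟩
  refine ⟨Σ k, ι k, fun p => d p.1 p.2, fun p => a p.1 p.2, hs, ?_, fun t ht => ?_⟩
  · rw [hs.tsum_sigma' h1]
    exact hs1.tsum_le_tsum h2 hM
  · have hs' : Summable fun p : Σ k, ι k => t ^ d p.1 p.2 • a p.1 p.2 :=
      Summable.of_norm_bounded hs fun p => norm_pow_smul_le ht _ _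
    beta_reduce
    rw [(hs'.hasSum.sigma fun k => h3 k t ht).tsum_eq]
    exact hs'.hasSum

theorem PowBound.sum [CompleteSpace V] {κ : Type} {C : ℝ} {f : κ → ℝ → V} {M : ℝ} (hC : 0 ≤ C) (s : Finset κ)
    (hf : ∀ k ∈ s, PowBound C (f k) M) :
    PowBound C (fun t => ∑ k ∈ s, f k t) (s.card * M) := by
  have := PowBound.tsum (κ := s) (f := fun k => f k) (M := fun _ => M) hC (fun k => hf k k.2)
    (hasSum_fintype _).summable
  rw [tsum_fintype, Finset.sum_const, Finset.card_univ, Fintype.card_coe, nsmul_eq_mul] at this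
  convert this using 2 with t
  rw [tsum_fintype, Finset.sum_coe_sort s (fun k => f k t)]

end PowBound

/-! ### The monogenic exponential of a power series -/

/-- The Fueter variable `zᵢ` as a linear map. -/
def zCLM {n : ℕ} (i : Fin n) : Para n →L[ℝ] Cl n :=
  (EuclideanSpace.proj i.succ).smulRight (1 : Cl n) - (EuclideanSpace.proj 0).smulRight (e i)

theorem zCLM_apply {n : ℕ} (i : Fin n) (x : Para n) : zCLM i x = z i x := by
  simp [zCLM, z, Algebra.algebraMap_eq_smul_one]

theorem PowBound.list_prod {n : ℕ} {ι : Type*} {C B : ℝ} (hC : 0 ≤ C)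
    {f : ι → ℝ → Cl n} (hf : ∀ i, PowBound C (f i) B) (l : List ι) :
    PowBound C (fun t => (l.map fun i => f i t).prod) ((‖mulCLM n‖ * B) ^ l.length * ‖(1 : Cl n)‖) := by
  induction l with
  | nil => simpa using PowBound.const C (1 : Cl n)
  | cons i l ih =>
    simp only [List.map_cons, List.prod_cons, List.length_cons]
    refine ((hf i).bilin hC ih (mulCLM n)).mono (le_of_eq ?_)
    ring

theorem norm_list_prod_le {n : ℕ} {ι : Type*} {B : ℝ} (hB : 0 ≤ B) {f : ι → Cl n}
    (hf : ∀ i, ‖f i‖ ≤ B) (l : List ι) :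
    ‖(l.map f).prod‖ ≤ (‖mulCLM n‖ * B) ^ l.length * ‖(1 : Cl n)‖ := by
  induction l with
  | nil => simp
  | cons i l ih =>
    simp only [List.map_cons, List.prod_cons, List.length_cons]
    calc _ ≤ ‖mulCLM n‖ * ‖f i‖ * ‖(l.map f).prod‖ := norm_mul_le_mulCLM _ _
      _ ≤ ‖mulCLM n‖ * B * ((‖mulCLM n‖ * B) ^ l.length * ‖(1 : Cl n)‖) := by
        gcongr
        exact hf i
      _ = _ := by ring

theorem card_arrangements_le {n : ℕ} (m : Fin n → ℕ) :
    (arrangements m).card ≤ n ^ ∑ i, m i := by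
  simpa using Finset.card_le_univ (arrangements m)

/-- A crude count suffices: any geometric growth in `k` is absorbed by the factor `1/k!` in `E`. -/
theorem card_piAntidiag_univ_le (n k : ℕ) :
    (Finset.piAntidiag (Finset.univ : Finset (Fin n)) k).card ≤ (2 ^ n) ^ k := by
  have hsub : Finset.piAntidiag (Finset.univ : Finset (Fin n)) k ⊆
      Fintype.piFinset fun _ => Finset.range (k + 1) := fun m hm => by
    rw [Finset.mem_piAntidiag] at hm
    simp only [Fintype.mem_piFinset, Finset.mem_range, Nat.lt_succ_iff, ← hm.1]
    exact fun i => Finset.single_le_sum (fun _ _ => Nat.zero_le _) (Finset.mem_univ i)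
  calc _ ≤ (k + 1) ^ n := by simpa using Finset.card_le_card hsub
    _ ≤ (2 ^ k) ^ n := Nat.pow_le_pow_left Nat.lt_two_pow_self _
    _ = _ := by rw [← pow_mul, ← pow_mul, mul_comm]

theorem norm_unitSum_le {n : ℕ} {D : ℝ} (hD : 0 ≤ D) (he : ∀ i : Fin n, ‖(e i : Cl n)‖ ≤ D)
    (m : Fin n → ℕ) :
    ‖(unitSum m : Cl n)‖ ≤ (n * (‖mulCLM n‖ * D)) ^ (∑ i, m i) * ‖(1 : Cl n)‖ := by
  have h : ∀ w ∈ arrangements m, ‖(List.ofFn fun p => (e (w p) : Cl n)).prod‖ ≤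
      (‖mulCLM n‖ * D) ^ (∑ i, m i) * ‖(1 : Cl n)‖ := fun w _ => by
    have := norm_list_prod_le hD he (List.ofFn w)
    rwa [List.map_ofFn, List.length_ofFn] at this
  have hcard : ((arrangements m).card : ℝ) ≤ (n : ℝ) ^ ∑ i, m i := by
    exact_mod_cast card_arrangements_le m
  calc _ ≤ ((arrangements m).card : ℝ) * ((‖mulCLM n‖ * D) ^ (∑ i, m i) * ‖(1 : Cl n)‖) := by
        simpa [unitSum] using norm_sum_le_of_le _ h
    _ ≤ (n : ℝ) ^ (∑ i, m i) * ((‖mulCLM n‖ * D) ^ (∑ i, m i) * ‖(1 : Cl n)‖) := by gcongr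
    _ = _ := by rw [mul_pow]; ring

/-- There are at most `n^k` arrangements, each a product of `k` factors, and the prefactor `m!/k!`
is at most 1 because `m!` divides `k!`. -/
theorem PowBound.fueter {n : ℕ} {C D : ℝ} (hC : 0 ≤ C) (hD : 0 ≤ D) {U : ℝ → Para n}
    (hU : ∀ i, PowBound C (fun t => z i (U t)) D) (m : Fin n → ℕ) :
    PowBound C (fun t => fueter m (U t)) ((n * (‖mulCLM n‖ * D)) ^ (∑ i, m i) * ‖(1 : Cl n)‖) := by
  have h : ∀ w ∈ arrangements m, PowBound C (fun t => (List.ofFn fun p => z (w p) (U t)).prod)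
      ((‖mulCLM n‖ * D) ^ (∑ i, m i) * ‖(1 : Cl n)‖) := fun w _ => by
    have := PowBound.list_prod hC hU (List.ofFn w)
    simpa only [List.map_ofFn, List.length_ofFn, Function.comp_def] using this
  have hcard : ((arrangements m).card : ℝ) ≤ (n : ℝ) ^ ∑ i, m i := by
    exact_mod_cast card_arrangements_le m
  set q : ℝ := ((∏ i, (m i).factorial : ℕ) : ℝ) / ((∑ i, m i).factorial : ℝ)
  have hq : ‖q • ContinuousLinearMap.id ℝ (Cl n)‖ ≤ 1 := by
    have h0 : 0 ≤ q := by positivity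
    have h1 : q ≤ 1 := div_le_one_of_le₀ (by
      exact_mod_cast Nat.le_of_dvd (Nat.factorial_pos _)
        (Nat.prod_factorial_dvd_factorial_sum Finset.univ m)) (by positivity)
    rw [norm_smul, Real.norm_of_nonneg h0]
    exact mul_le_one₀ h1 (norm_nonneg _) ContinuousLinearMap.norm_id_le
  refine ((PowBound.sum hC _ h).clm hC (q • ContinuousLinearMap.id ℝ (Cl n))).mono ?_
  calc _ ≤ 1 * ((n : ℝ) ^ (∑ i, m i) * ((‖mulCLM n‖ * D) ^ (∑ i, m i) * ‖(1 : Cl n)‖)) := by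
        gcongr
    _ = _ := by rw [mul_pow]; ring

/-- If the paravector-valued `U` has an absolutely convergent power series expansion, then so has
`E ∘ U`, with a bound that depends only on that of `U`. -/
theorem PowBound.exists_E (n : ℕ) {C B : ℝ} (hC : 0 ≤ C) :
    ∃ M, ∀ U : ℝ → Para n, PowBound C U B → PowBound C (fun t => E (U t)) M := by
  -- One constant dominating both the Fueter variables along `U` and the units `eᵢ`. The absolute
  -- value keeps it nonnegative, as `B` is fixed before any `U` is known.
  set D : ℝ := ∑ i : Fin n, (‖zCLM i‖ * |B| + ‖(e i : Cl n)‖) with hDdef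
  have hD0 : 0 ≤ D := by positivity
  have hDi : ∀ i : Fin n, ‖zCLM i‖ * |B| + ‖(e i : Cl n)‖ ≤ D := fun i =>
    Finset.single_le_sum (f := fun i : Fin n => ‖zCLM i‖ * |B| + ‖(e i : Cl n)‖)
      (fun i _ => by positivity) (Finset.mem_univ i)
  have he : ∀ i : Fin n, ‖(e i : Cl n)‖ ≤ D := fun i =>
    (le_add_of_nonneg_left (by positivity)).trans (hDi i)
  set Q : ℝ := n * (‖mulCLM n‖ * D) with hQ
  have hQ0 : 0 ≤ Q := by positivity
  set R : ℝ := ‖mulCLM n‖ * ‖(1 : Cl n)‖ * ‖(1 : Cl n)‖ with hR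
  have hR0 : 0 ≤ R := by positivity
  -- `(2^n)^k` counts the multi-indices, one `Q^k` bounds `P_m`, and the other bounds `e'_m`.
  set M : ℕ → ℝ := fun k => (k.factorial : ℝ)⁻¹ * ((2 ^ n * Q * Q) ^ k * R) with hM
  have hMs : Summable M := by
    refine ((Real.summable_pow_div_factorial (2 ^ n * Q * Q)).mul_right R).congr fun k => ?_
    rw [hM]; ring
  refine ⟨∑' k, M k, fun U hU => ?_⟩
  have hz : ∀ i : Fin n, PowBound C (fun t => z i (U t)) D := fun i => by
    have := hU.clm hC (zCLM i)
    simp only [zCLM_apply] at this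
    refine this.mono (le_trans ?_ (hDi i))
    calc ‖zCLM i‖ * B ≤ ‖zCLM i‖ * |B| := by gcongr; exact le_abs_self B
      _ ≤ _ := le_add_of_nonneg_right (norm_nonneg _)
  refine PowBound.tsum hC (fun k => ?_) hMs
  have hterm : ∀ m ∈ Finset.piAntidiag (Finset.univ : Finset (Fin n)) k,
      PowBound C (fun t => Monogenic.fueter m (U t) * unitSum m) (Q ^ k * Q ^ k * R) := fun m hm => by
    have hk : ∑ i, m i = k := (Finset.mem_piAntidiag.1 hm).1
    have h1 := PowBound.fueter hC hD0 hz m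
    have h2 := (PowBound.const C (unitSum m : Cl n)).mono (norm_unitSum_le hD0 he m)
    refine (h1.bilin hC h2 (mulCLM n)).mono (le_of_eq ?_)
    rw [hk, hR]; ring
  have hsum := (PowBound.sum hC _ hterm).clm hC
    (((k.factorial : ℝ)⁻¹) • ContinuousLinearMap.id ℝ (Cl n))
  refine hsum.mono ?_
  have hcard : ((Finset.piAntidiag (Finset.univ : Finset (Fin n)) k).card : ℝ) ≤ (2 ^ n) ^ k := by
    exact_mod_cast card_piAntidiag_univ_le n k
  have hn : ‖((k.factorial : ℝ)⁻¹) • ContinuousLinearMap.id ℝ (Cl n)‖ ≤ (k.factorial : ℝ)⁻¹ := by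
    rw [norm_smul, Real.norm_of_nonneg (by positivity)]
    exact mul_le_of_le_one_right (by positivity) ContinuousLinearMap.norm_id_le
  calc _ ≤ (k.factorial : ℝ)⁻¹ * ((2 ^ n) ^ k * (Q ^ k * Q ^ k * R)) := by gcongr
    _ = M k := by rw [hM]; ring

/-- The functional `g ↦ ∑ⱼ Zⱼ g(hⱼ) - g(a)` is controlled by its moments. -/
theorem PowBound.norm_functional_le {n : ℕ} {C M ε a : ℝ} {g : ℝ → Cl n} (hg : PowBound C g M)
    (ha : |a| ≤ C) (s : Finset ℕ) (h : ℕ → ℝ) (hh : ∀ j ∈ s, |h j| ≤ C) (Z : ℕ → Cl n)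
    (hε : 0 ≤ ε) (hd : ∀ k : ℕ, ‖∑ j ∈ s, h j ^ k • Z j - a ^ k • (1 : Cl n)‖ ≤ ε * C ^ k) :
    ‖∑ j ∈ s, Z j * g (h j) - g a‖ ≤ ‖mulCLM n‖ * ε * M := by
  obtain ⟨ι, d, b, h1, h2, h3⟩ := hg
  -- Expand `g` at every `hⱼ` and at `a`. The scalars `hⱼ^d` pass through the product, so the moment
  -- error factors out on the left of each coefficient.
  have hs1 : HasSum (fun i => (∑ j ∈ s, h j ^ d i • Z j - a ^ d i • (1 : Cl n)) * b i)
      (∑ j ∈ s, Z j * g (h j) - g a) := by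
    have hj : ∀ j ∈ s, HasSum (fun i => Z j * (h j ^ d i • b i)) (Z j * g (h j)) := fun j hj =>
      (h3 _ (hh j hj)).mapL (mulCLM n (Z j))
    refine ((hasSum_sum hj).sub (h3 a ha)).congr_fun fun i => ?_
    simp [sub_mul, Finset.sum_mul]
  have hle : ∀ i, ‖(∑ j ∈ s, h j ^ d i • Z j - a ^ d i • (1 : Cl n)) * b i‖ ≤
      ‖mulCLM n‖ * ε * (C ^ d i * ‖b i‖) := fun i => by
    calc _ ≤ _ := norm_mul_le_mulCLM _ _
      _ ≤ ‖mulCLM n‖ * (ε * C ^ d i) * ‖b i‖ := by gcongr; exact hd _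
      _ = _ := by ring
  rw [← hs1.tsum_eq]
  refine (tsum_of_norm_bounded (h1.hasSum.mul_left _) hle).trans ?_
  gcongr

/-! ### Gradient estimates for monogenic functions -/

/-- The units `1, e₁, …, eₙ`. -/
def paraUnit {n : ℕ} : Fin (n + 1) → Cl n := Fin.cons 1 e

/-- The conjugate units `1, -e₁, …, -eₙ`. -/
def paraConj {n : ℕ} : Fin (n + 1) → Cl n := Fin.cons 1 fun i => -e i

theorem paraConj_mul_paraUnit_self {n : ℕ} (i : Fin (n + 1)) :
    paraConj i * paraUnit i = (1 : Cl n) := by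
  induction i using Fin.cases <;> simp [paraConj, paraUnit, e_mul_self]

/-- Polarised form of `x̄ x = |x|²`; it removes the off-diagonal terms in `two_smul_sum_smul_eq`. -/
theorem paraConj_mul_paraUnit_add {n : ℕ} {i j : Fin (n + 1)} (h : i ≠ j) :
    paraConj i * paraUnit j + paraConj j * paraUnit i = (0 : Cl n) := by
  induction i using Fin.cases with
  | zero =>
    induction j using Fin.cases with
    | zero => exact absurd rfl h
    | succ j => simp [paraConj, paraUnit]
  | succ i =>
    induction j using Fin.cases with
    | zero => simp [paraConj, paraUnit]
    | succ j =>
      have : i ≠ j := fun hij => h (by rw [hij])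
      simp [paraConj, paraUnit, e_mul_e_of_ne this]

theorem LeftMonogenic.sum_eq_zero {n : ℕ} {F : Para n → Cl n} (hF : LeftMonogenic F) (x : Para n) :
    ∑ i, paraUnit i * fderiv ℝ F x (EuclideanSpace.single i 1) = 0 := by
  rw [Fin.sum_univ_succ]
  simpa [paraUnit] using hF.2 x

theorem leftMonogenic_of_sum_eq_zero {n : ℕ} {F : Para n → Cl n} (hF : ContDiff ℝ 1 F)
    (h : ∀ x, ∑ i, paraUnit i * fderiv ℝ F x (EuclideanSpace.single i 1) = 0) :
    LeftMonogenic F := by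
  refine ⟨hF, fun x => ?_⟩
  have := h x
  rw [Fin.sum_univ_succ] at this
  simpa [paraUnit] using this

/-- If `∑ eᵢ Dᵢ = 0` then the radial derivative `∑ yᵢ Dᵢ` is a combination of angular ones. -/
theorem two_smul_sum_smul_eq {n : ℕ} (y : Fin (n + 1) → ℝ) (D : Fin (n + 1) → Cl n)
    (hD : ∑ i, paraUnit i * D i = 0) :
    (2 : ℝ) • ∑ i, y i • D i =
      ∑ i, ∑ j, paraConj i * paraUnit j * (y j • D i - y i • D j) := by
  -- The equation for `D`, multiplied on the left by the conjugate of `y`.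
  have h1 : ∑ i, ∑ j, (paraConj i * paraUnit j) * (y i • D j) = 0 := by
    refine Finset.sum_eq_zero fun i _ => ?_
    have : ∑ j, (paraConj i * paraUnit j) * (y i • D j) =
        y i • (paraConj i * ∑ j, paraUnit j * D j) := by
      simp only [Finset.mul_sum, Finset.smul_sum, mul_smul_comm, mul_assoc]
    rw [this, hD, mul_zero, smul_zero]
  have h2 : ∑ i, ∑ j, (paraConj j * paraUnit i) * (y j • D i) = 0 := by
    rw [Finset.sum_comm]; exact h1
  have h3 : ∀ i, ∑ j, ((paraConj i * paraUnit j) * (y j • D i) +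
      (paraConj j * paraUnit i) * (y j • D i)) = (2 : ℝ) • y i • D i := fun i => by
    rw [Finset.sum_eq_single i]
    · rw [paraConj_mul_paraUnit_self, one_mul, two_smul]
    · intro j _ hj
      rw [← add_mul, paraConj_mul_paraUnit_add hj.symm, zero_mul]
    · simp
  calc (2 : ℝ) • ∑ i, y i • D i = ∑ i, ∑ j, ((paraConj i * paraUnit j) * (y j • D i) +
      (paraConj j * paraUnit i) * (y j • D i)) := by
        rw [Finset.smul_sum]; exact Finset.sum_congr rfl fun i _ => (h3 i).symm
    _ = ∑ i, ∑ j, (paraConj i * paraUnit j) * (y j • D i) := by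
        simp only [Finset.sum_add_distrib, h2, add_zero]
    _ = _ := by
        simp only [mul_sub, Finset.sum_sub_distrib, h1, sub_zero]

theorem fderiv_apply_eq_sum {n : ℕ} (L : Para n →L[ℝ] Cl n) (y : Para n) :
    L y = ∑ i, y i • L (EuclideanSpace.single i 1) := by
  conv_lhs => rw [← (EuclideanSpace.basisFun (Fin (n + 1)) ℝ).sum_repr y]
  simp

/-- A smooth radial function supported in the unit ball. -/
def cutoff {n : ℕ} (y : Para n) : ℝ := Real.smoothTransition (1 - ‖y‖ ^ 2)

theorem contDiff_cutoff {n : ℕ} {k : ℕ∞} : ContDiff ℝ k (cutoff (n := n)) :=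
  Real.smoothTransition.contDiff.comp (contDiff_const.sub (contDiff_norm_sq ℝ))

theorem cutoff_nonneg {n : ℕ} (y : Para n) : 0 ≤ cutoff y := Real.smoothTransition.nonneg _

theorem cutoff_neg {n : ℕ} (y : Para n) : cutoff (-y) = cutoff y := by simp [cutoff]

theorem tsupport_cutoff_subset {n : ℕ} : tsupport (cutoff (n := n)) ⊆ Metric.closedBall 0 1 := by
  refine closure_minimal (fun y hy => ?_) Metric.isClosed_closedBall
  rw [mem_closedBall_zero_iff]
  by_contra! h
  refine hy (Real.smoothTransition.zero_of_nonpos ?_)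
  nlinarith

theorem hasCompactSupport_cutoff {n : ℕ} : HasCompactSupport (cutoff (n := n)) :=
  (isCompact_closedBall (0 : Para n) 1).of_isClosed_subset (isClosed_tsupport _)
    tsupport_cutoff_subset

theorem integral_cutoff_pos (n : ℕ) : 0 < ∫ y : Para n, cutoff y := by
  refine (contDiff_cutoff (k := 0)).continuous.integral_pos_of_hasCompactSupport_nonneg_nonzero
    hasCompactSupport_cutoff cutoff_nonneg (x := 0) ?_
  simp [cutoff]

theorem fderiv_cutoff_single {n : ℕ} (y : Para n) (i : Fin (n + 1)) :
    fderiv ℝ cutoff y (EuclideanSpace.single i 1) =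
      -2 * deriv Real.smoothTransition (1 - ‖y‖ ^ 2) * y i := by
  have h1 : HasFDerivAt (fun y : Para n => 1 - ‖y‖ ^ 2) (-(2 • innerSL ℝ y)) y :=
    (hasStrictFDerivAt_norm_sq y).hasFDerivAt.const_sub 1
  have h2 : HasDerivAt Real.smoothTransition (deriv Real.smoothTransition (1 - ‖y‖ ^ 2))
      (1 - ‖y‖ ^ 2) :=
    ((Real.smoothTransition.contDiff (n := 1)).differentiable (by simp) _).hasDerivAt
  have h3 := (h2.comp_hasFDerivAt y h1).fderiv
  have h4 : fderiv ℝ (cutoff (n := n)) y = _ := h3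
  rw [h4]
  simp [EuclideanSpace.inner_single_right]
  ring

theorem integrable_smul_of_hasCompactSupport {n : ℕ} {f : Para n → ℝ} {g : Para n → Cl n}
    (hf : Continuous f) (hfs : HasCompactSupport f) (hg : Continuous g) :
    MeasureTheory.Integrable fun y => f y • g y :=
  (hf.smul hg).integrable_of_hasCompactSupport hfs.smul_right

theorem integral_smul_fderiv_eq {n : ℕ} {f : Para n → ℝ} {g : Para n → Cl n}
    (hf : ContDiff ℝ 1 f) (hfs : HasCompactSupport f) (hg : ContDiff ℝ 1 g) (v : Para n) :
    ∫ y, f y • fderiv ℝ g y v = -∫ y, fderiv ℝ f y v • g y := by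
  have hf' : Continuous fun y => fderiv ℝ f y v :=
    (hf.continuous_fderiv (by simp)).clm_apply continuous_const
  have hg' : Continuous fun y => fderiv ℝ g y v :=
    (hg.continuous_fderiv (by simp)).clm_apply continuous_const
  refine integral_smul_fderiv_eq_neg_fderiv_smul_of_integrable
    (integrable_smul_of_hasCompactSupport hf' (hfs.fderiv_apply ℝ v) hg.continuous)
    (integrable_smul_of_hasCompactSupport hf.continuous hfs hg')
    (integrable_smul_of_hasCompactSupport hf.continuous hfs hg.continuous)
    (fun x _ => hf.differentiable (by simp) x) (fun x _ => hg.differentiable (by simp) x)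

/-- Rotation fields annihilate radial functions: after integration by parts, both terms carry the
same factor, proportional to `yᵢ yⱼ`, and cancel. -/
theorem integral_cutoff_smul_angular {n : ℕ} {G : Para n → Cl n} (hG : ContDiff ℝ 1 G)
    (i j : Fin (n + 1)) :
    ∫ y : Para n, cutoff y • (y j • fderiv ℝ G y (EuclideanSpace.single i 1) -
      y i • fderiv ℝ G y (EuclideanSpace.single j 1)) = 0 := by
  rcases eq_or_ne i j with rfl | hij
  · simp
  have hη : ContDiff ℝ 1 (cutoff (n := n)) := contDiff_cutoff (k := 1)
  have hc : ∀ k : Fin (n + 1), ContDiff ℝ 1 fun y : Para n => cutoff y * y k := fun k =>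
    hη.mul (EuclideanSpace.proj k : Para n →L[ℝ] ℝ).contDiff
  have hs : ∀ k : Fin (n + 1), HasCompactSupport fun y : Para n => cutoff y * y k := fun k =>
    hasCompactSupport_cutoff.mul_right
  have hG' : ∀ v, Continuous fun y => fderiv ℝ G y v := fun v =>
    (hG.continuous_fderiv (by simp)).clm_apply continuous_const
  have hd : ∀ k l : Fin (n + 1), k ≠ l → ∀ y : Para n,
      fderiv ℝ (fun y : Para n => cutoff y * y k) y (EuclideanSpace.single l 1) =
        -2 * deriv Real.smoothTransition (1 - ‖y‖ ^ 2) * y l * y k := fun k l hkl y => by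
    have h1 : HasFDerivAt (fun y : Para n => y k)
      (EuclideanSpace.proj k : Para n →L[ℝ] ℝ) y :=
      (EuclideanSpace.proj k : Para n →L[ℝ] ℝ).hasFDerivAt
    rw [((hη.differentiable (by simp) y).hasFDerivAt.fun_mul h1).fderiv]
    simp [fderiv_cutoff_single, hkl]
    ring
  have h1 := integral_smul_fderiv_eq (hc j) (hs j) hG (EuclideanSpace.single i 1)
  have h2 := integral_smul_fderiv_eq (hc i) (hs i) hG (EuclideanSpace.single j 1)
  calc _ = ∫ y : Para n, ((cutoff y * y j) • fderiv ℝ G y (EuclideanSpace.single i 1) -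
      (cutoff y * y i) • fderiv ℝ G y (EuclideanSpace.single j 1)) := by
        simp only [smul_sub, smul_smul]
    _ = 0 := by
      rw [MeasureTheory.integral_sub
        (integrable_smul_of_hasCompactSupport (hc j).continuous (hs j) (hG' _))
        (integrable_smul_of_hasCompactSupport (hc i).continuous (hs i) (hG' _)), h1, h2,
        sub_eq_zero]
      congr 2
      ext1 y
      rw [hd j i hij.symm, hd i j hij]
      ring_nf

theorem LeftMonogenic.integral_cutoff_smul_radial {n : ℕ} {G : Para n → Cl n}
    (hG : LeftMonogenic G) : ∫ y : Para n, cutoff y • fderiv ℝ G y y = 0 := by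
  have hG' : ∀ v, Continuous fun y => fderiv ℝ G y v := fun v =>
    (hG.1.continuous_fderiv (by simp)).clm_apply continuous_const
  have hη : Continuous (cutoff (n := n)) := (contDiff_cutoff (k := 0)).continuous
  have hy : ∀ k : Fin (n + 1), Continuous fun y : Para n => y k := fun k =>
    (EuclideanSpace.proj k : Para n →L[ℝ] ℝ).continuous
  have hpt : ∀ y : Para n, (2 : ℝ) • (cutoff y • fderiv ℝ G y y) = ∑ i, ∑ j,
      mulCLM n (paraConj i * paraUnit j) (cutoff y •
        (y j • fderiv ℝ G y (EuclideanSpace.single i 1) -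
          y i • fderiv ℝ G y (EuclideanSpace.single j 1))) := fun y => by
    rw [smul_comm, fderiv_apply_eq_sum (fderiv ℝ G y) y,
      two_smul_sum_smul_eq _ _ (hG.sum_eq_zero y)]
    simp only [Finset.smul_sum, mulCLM_apply, mul_smul_comm]
  have hint : ∀ i j : Fin (n + 1), MeasureTheory.Integrable fun y : Para n => cutoff y •
        (y j • fderiv ℝ G y (EuclideanSpace.single i 1) -
          y i • fderiv ℝ G y (EuclideanSpace.single j 1)) := fun i j =>
    integrable_smul_of_hasCompactSupport hη hasCompactSupport_cutoff
      (((hy j).smul (hG' _)).sub ((hy i).smul (hG' _)))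
  have h2 : (2 : ℝ) • ∫ y : Para n, cutoff y • fderiv ℝ G y y = 0 := by
    rw [← MeasureTheory.integral_smul]
    simp only [hpt]
    rw [MeasureTheory.integral_finsetSum _ fun i _ => MeasureTheory.integrable_finsetSum _
      fun j _ => (mulCLM n (paraConj i * paraUnit j)).integrable_comp (hint i j)]
    refine Finset.sum_eq_zero fun i _ => ?_
    rw [MeasureTheory.integral_finsetSum _ fun j _ =>
      (mulCLM n (paraConj i * paraUnit j)).integrable_comp (hint i j)]
    refine Finset.sum_eq_zero fun j _ => ?_
    rw [ContinuousLinearMap.integral_comp_comm _ (hint i j), integral_cutoff_smul_angular hG.1,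
      map_zero]
  simpa using h2

theorem fderiv_comp_add_smul {n : ℕ} {F : Para n → Cl n} (hF : Differentiable ℝ F) (x : Para n)
    (s : ℝ) (y : Para n) : fderiv ℝ (fun y => F (x + s • y)) y =
      (fderiv ℝ F (x + s • y)).comp (s • ContinuousLinearMap.id ℝ (Para n)) :=
  ((hF _).hasFDerivAt.comp y (((hasFDerivAt_id y).const_smul s).const_add x)).fderiv

theorem LeftMonogenic.comp_add_smul {n : ℕ} {F : Para n → Cl n} (hF : LeftMonogenic F)
    (x : Para n) (s : ℝ) : LeftMonogenic fun y => F (x + s • y) := by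
  refine leftMonogenic_of_sum_eq_zero
    (hF.1.comp (by fun_prop)) fun y => ?_
  simp only [fderiv_comp_add_smul (hF.1.differentiable (by simp)),
    ContinuousLinearMap.comp_apply, _root_.smul_apply,
    ContinuousLinearMap.id_apply, map_smul, mul_smul_comm, ← Finset.smul_sum]
  rw [hF.sum_eq_zero, smul_zero]

/-- For `s ≠ 0`, rescale to the radial identity at the origin. For `s = 0` the integrand is odd. -/
theorem LeftMonogenic.integral_cutoff_smul_fderiv {n : ℕ} {F : Para n → Cl n}
    (hF : LeftMonogenic F) (x : Para n) (s : ℝ) :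
    ∫ y : Para n, cutoff y • fderiv ℝ F (x + s • y) y = 0 := by
  rcases eq_or_ne s 0 with rfl | hs
  · have h := MeasureTheory.integral_neg_eq_self
      (fun y : Para n => cutoff y • fderiv ℝ F (x + (0 : ℝ) • y) y) MeasureTheory.volume
    simp only [zero_smul, add_zero, cutoff_neg, map_neg, smul_neg, neg_zero,
      MeasureTheory.integral_neg] at h ⊢
    rw [neg_eq_iff_add_eq_zero, ← two_smul ℝ] at h
    exact (smul_eq_zero.1 h).resolve_left two_ne_zero
  · have h := (hF.comp_add_smul x s).integral_cutoff_smul_radial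
    have hd : ∀ y, fderiv ℝ (fun y => F (x + s • y)) y y = s • fderiv ℝ F (x + s • y) y := fun y => by
      rw [fderiv_comp_add_smul (hF.1.differentiable (by simp))]
      simp
    simp only [hd, smul_comm _ s, MeasureTheory.integral_smul] at h
    exact (smul_eq_zero.1 h).resolve_left hs

/-- The mean value property. -/
theorem LeftMonogenic.integral_cutoff_smul {n : ℕ} {F : Para n → Cl n} (hF : LeftMonogenic F)
    (x : Para n) : ∫ y : Para n, cutoff y • F (x + y) = (∫ y : Para n, cutoff y) • F x := by
  have hη : Continuous (cutoff (n := n)) := (contDiff_cutoff (k := 0)).continuous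
  have hF' : Continuous (fderiv ℝ F) := hF.1.continuous_fderiv (by simp)
  -- The weighted mean over the ball scaled by `s` has zero derivative in `s`; comparing `s = 1`
  -- with `s = 0` then gives the claim.
  have key : ∀ s₀ : ℝ, HasDerivAt (fun s => ∫ y : Para n, cutoff y • F (x + s • y)) 0 s₀ := by
    intro s₀
    obtain ⟨A, hA⟩ := (isCompact_closedBall x (|s₀| + 1)).exists_bound_of_continuousOn
      hF'.continuousOn
    have := (hasDerivAt_integral_of_dominated_loc_of_deriv_le (μ := MeasureTheory.volume)
      (F := fun s (y : Para n) => cutoff y • F (x + s • y))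
      (F' := fun s (y : Para n) => cutoff y • fderiv ℝ F (x + s • y) y)
      (bound := fun y => cutoff y * A) (x₀ := s₀) (Metric.ball_mem_nhds s₀ one_pos)
      (Eventually.of_forall fun s => ?_) ?_ ?_ ?_ ?_ ?_).2
    · rwa [hF.integral_cutoff_smul_fderiv] at this
    · exact (hη.smul (hF.1.continuous.comp (by fun_prop))).aestronglyMeasurable
    · exact integrable_smul_of_hasCompactSupport hη hasCompactSupport_cutoff
        (hF.1.continuous.comp (by fun_prop))
    · exact (hη.smul ((hF'.comp (by fun_prop)).clm_apply continuous_id)).aestronglyMeasurable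
    · refine Eventually.of_forall fun y s hs => ?_
      by_cases hy : y ∈ Metric.closedBall (0 : Para n) 1
      · rw [mem_closedBall_zero_iff] at hy
        rw [norm_smul, Real.norm_of_nonneg (cutoff_nonneg y)]
        have hs' : |s| ≤ |s₀| + 1 := by
          rw [Metric.mem_ball, Real.dist_eq] at hs
          linarith [abs_sub_abs_le_abs_sub s s₀]
        have hA' := hA (x + s • y) (by
          rw [mem_closedBall_iff_norm, add_sub_cancel_left, norm_smul, Real.norm_eq_abs]
          nlinarith [abs_nonneg s, norm_nonneg y])
        refine mul_le_mul_of_nonneg_left ?_ (cutoff_nonneg y)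
        calc _ ≤ ‖fderiv ℝ F (x + s • y)‖ * ‖y‖ := ContinuousLinearMap.le_opNorm _ _
          _ ≤ ‖fderiv ℝ F (x + s • y)‖ * 1 := by gcongr
          _ ≤ A := by rwa [mul_one]
      · have : cutoff y = 0 := image_eq_zero_of_notMem_tsupport fun h =>
          hy (tsupport_cutoff_subset h)
        simp [this]
    · exact (hη.mul continuous_const).integrable_of_hasCompactSupport
        hasCompactSupport_cutoff.mul_right
    · refine Eventually.of_forall fun y s _ => ?_
      have h1 : HasDerivAt (fun s : ℝ => x + s • y) y s := by
        simpa using ((hasDerivAt_id s).smul_const y).const_add x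
      exact ((hF.1.differentiable (by simp) _).hasFDerivAt.comp_hasDerivAt s h1).const_smul (cutoff y)
  have h01 := is_const_of_deriv_eq_zero (fun s => (key s).differentiableAt)
    (fun s => (key s).deriv) 1 0
  simp only [one_smul, zero_smul, add_zero] at h01
  rw [h01, integral_smul_const]

/-- By the mean value property `F` is, up to a constant, its own convolution with a smooth function.
-/
theorem LeftMonogenic.contDiff {n : ℕ} {F : Para n → Cl n} (hF : LeftMonogenic F) (k : ℕ∞) :
    ContDiff ℝ k F := by
  have h : F = fun x => (∫ y : Para n, cutoff y)⁻¹ • (MeasureTheory.convolution cutoff F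
      (ContinuousLinearMap.lsmul ℝ ℝ) MeasureTheory.volume) x := by
    ext1 x
    rw [eq_inv_smul_iff₀ (integral_cutoff_pos n).ne', ← hF.integral_cutoff_smul,
      MeasureTheory.convolution_def, ← MeasureTheory.integral_neg_eq_self]
    simp [cutoff_neg, sub_eq_add_neg]
  rw [h]
  have hconv := hasCompactSupport_cutoff.contDiff_convolution_left
    (μ := (MeasureTheory.volume : MeasureTheory.Measure (Para n)))
    (ContinuousLinearMap.lsmul ℝ ℝ : ℝ →L[ℝ] Cl n →L[ℝ] Cl n)
    (contDiff_cutoff (k := k)) hF.1.continuous.locallyIntegrable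
  exact hconv.const_smul (∫ y : Para n, cutoff y)⁻¹

/-- Differentiate the equation along `v` and swap the two derivatives; this closure is what allows
the gradient estimate to be iterated. -/
theorem LeftMonogenic.fderiv_apply {n : ℕ} {F : Para n → Cl n} (hF : LeftMonogenic F)
    (v : Para n) : LeftMonogenic fun x => fderiv ℝ F x v := by
  have h2 : ContDiff ℝ 2 F := hF.contDiff 2
  have h1 : ContDiff ℝ 1 (fderiv ℝ F) := h2.fderiv_right (by norm_num)
  have hd : ∀ x w, fderiv ℝ (fun x => fderiv ℝ F x v) x w = fderiv ℝ (fderiv ℝ F) x v w :=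
    fun x w => by
    rw [((h1.differentiable (by simp) x).hasFDerivAt.clm_apply (hasFDerivAt_const v x)).fderiv]
    simpa using (h2.contDiffAt.isSymmSndFDerivAt (by simp)).eq w v
  refine leftMonogenic_of_sum_eq_zero (h1.clm_apply contDiff_const) fun x => ?_
  simp only [hd]
  have h0 : HasFDerivAt (fun x => ∑ i, mulCLM n (paraUnit i)
      (fderiv ℝ F x (EuclideanSpace.single i 1))) (∑ i, (mulCLM n (paraUnit i)).comp
        ((fderiv ℝ (fderiv ℝ F) x).flip (EuclideanSpace.single i 1))) x := by
    refine HasFDerivAt.fun_sum fun i _ => (mulCLM n (paraUnit i)).hasFDerivAt.comp x ?_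
    have := (h1.differentiable (by simp) x).hasFDerivAt.clm_apply
      (hasFDerivAt_const (EuclideanSpace.single i (1 : ℝ)) x)
    simpa using this
  simp only [mulCLM_apply, hF.sum_eq_zero] at h0
  have := congrArg (fun L : Para n →L[ℝ] Cl n => L v) (h0.unique (hasFDerivAt_const 0 x))
  simpa using this

/-- The derivative of a monogenic function of exponential type satisfies the same growth bound, up
to a constant that depends only on the type. -/
theorem exists_fderiv_bound (n : ℕ) (v : Para n) {σ : ℝ} (hσ : 0 ≤ σ) :
    ∃ A, 0 ≤ A ∧ ∀ (F : Para n → Cl n) (ε : ℝ), LeftMonogenic F →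
      (∀ x, ‖F x‖ ≤ ε * Real.exp (σ * ‖x‖)) →
      ∀ x, ‖fderiv ℝ F x v‖ ≤ A * ε * Real.exp (σ * ‖x‖) := by
  set c : ℝ := ∫ y : Para n, cutoff y with hc
  have hc0 : 0 < c := integral_cutoff_pos n
  have hη : ContDiff ℝ 1 (cutoff (n := n)) := contDiff_cutoff (k := 1)
  have hη' : Continuous fun y : Para n => fderiv ℝ cutoff y v :=
    (hη.continuous_fderiv (by simp)).clm_apply continuous_const
  have hηs : HasCompactSupport fun y : Para n => fderiv ℝ cutoff y v :=
    hasCompactSupport_cutoff.fderiv_apply ℝ v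
  set I : ℝ := ∫ y : Para n, ‖fderiv ℝ cutoff y v‖ with hI
  have hI0 : 0 ≤ I := MeasureTheory.integral_nonneg fun y => norm_nonneg _
  -- The mean value property for the derivative, with the derivative moved onto the cutoff, leaves
  -- only `F` on a unit ball around `x`. Moving by at most 1 costs `exp σ`.
  refine ⟨c⁻¹ * I * Real.exp σ, by positivity, fun F ε hF hb x => ?_⟩
  have hε : 0 ≤ ε := by simpa using (norm_nonneg _).trans (hb 0)
  have hFx : ContDiff ℝ 1 fun y => F (x + y) := hF.1.comp (contDiff_const.add contDiff_id)
  have h1 := (hF.fderiv_apply v).integral_cutoff_smul x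
  have h2 := integral_smul_fderiv_eq hη hasCompactSupport_cutoff hFx v
  simp only [fderiv_comp_add_left] at h2
  rw [h2] at h1
  have h3 : ‖∫ y : Para n, fderiv ℝ cutoff y v • F (x + y)‖ ≤
      I * (ε * Real.exp (σ * (‖x‖ + 1))) := by
    rw [hI, ← MeasureTheory.integral_mul_const]
    refine MeasureTheory.norm_integral_le_of_norm_le
      ((hη'.norm.integrable_of_hasCompactSupport hηs.norm).mul_const _)
      (Eventually.of_forall fun y => ?_)
    by_cases hy : y ∈ Metric.closedBall (0 : Para n) 1
    · rw [mem_closedBall_zero_iff] at hy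
      rw [norm_smul]
      gcongr
      refine (hb _).trans ?_
      gcongr
      exact (norm_add_le _ _).trans (by gcongr)
    · have : fderiv ℝ (cutoff (n := n)) y = 0 := fderiv_of_notMem_tsupport ℝ fun h =>
        hy (tsupport_cutoff_subset h)
      simp [this]
  have h4 : c * ‖fderiv ℝ F x v‖ ≤ I * (ε * Real.exp (σ * (‖x‖ + 1))) := by
    rw [← Real.norm_of_nonneg hc0.le, ← norm_smul, ← h1, norm_neg]
    exact h3
  rw [mul_add, mul_one, Real.exp_add] at h4
  calc ‖fderiv ℝ F x v‖ = c⁻¹ * (c * ‖fderiv ℝ F x v‖) := by field_simp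
    _ ≤ c⁻¹ * (I * (ε * (Real.exp (σ * ‖x‖) * Real.exp σ))) := by gcongr
    _ = _ := by ring

/-! ### The monogenic exponential on a coordinate axis -/

theorem z_single {n : ℕ} (i j : Fin n) (t : ℝ) :
    z j (EuclideanSpace.single i.succ t) = algebraMap ℝ (Cl n) (if j = i then t else 0) := by
  simp [z]

theorem arrangements_single {n : ℕ} (i : Fin n) (k : ℕ) :
    arrangements (Pi.single i k) = {fun _ => i} := by
  ext w
  simp only [arrangements, Finset.mem_filter, Finset.mem_univ, true_and, Finset.mem_singleton]
  constructor
  · intro h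
    ext1 p
    by_contra hp
    have h0 := h (w p)
    rw [Pi.single_eq_of_ne hp, Finset.card_eq_zero] at h0
    exact Finset.notMem_empty p (h0 ▸ by simp)
  · rintro rfl j
    rcases eq_or_ne j i with rfl | hj
    · simp
    · simp [hj, hj.symm]

theorem eq_single_of_const_mem_arrangements {n : ℕ} {m : Fin n → ℕ} {i : Fin n}
    (h : (fun _ => i) ∈ arrangements m) : m = Pi.single i (∑ j, m j) := by
  simp only [arrangements, Finset.mem_filter, Finset.mem_univ, true_and] at h
  ext1 j
  rw [← h j]
  rcases eq_or_ne j i with rfl | hj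
  · simp
  · simp [hj, hj.symm]

theorem fueter_single_mul_unitSum {n : ℕ} (i : Fin n) (t : ℝ) (k : ℕ) :
    fueter (Pi.single i k) (EuclideanSpace.single i.succ t) * unitSum (Pi.single i k) =
      t ^ k • (e i : Cl n) ^ k := by
  have hsum : ∑ j, (Pi.single i k : Fin n → ℕ) j = k := by simp
  have hprod : ∏ j, ((Pi.single i k : Fin n → ℕ) j).factorial = k.factorial := by
    rw [Finset.prod_eq_single i (fun j _ hj => by simp [hj]) (by simp)]
    simp
  rw [fueter, unitSum, arrangements_single, hprod]
  simp only [Finset.sum_singleton, List.ofFn_const, List.prod_replicate, hsum, z_single, if_true]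
  rw [div_self (by positivity), one_smul, ← map_pow, Algebra.algebraMap_eq_smul_one,
    smul_mul_assoc, one_mul]

theorem fueter_single_eq_zero {n : ℕ} (i : Fin n) (t : ℝ) {m : Fin n → ℕ}
    (hm : m ≠ Pi.single i (∑ j, m j)) :
    fueter m (EuclideanSpace.single i.succ t) = (0 : Cl n) := by
  rw [fueter]
  refine smul_eq_zero_of_right _ (Finset.sum_eq_zero fun w hw => ?_)
  obtain ⟨p, hp⟩ : ∃ p, w p ≠ i := by
    by_contra! h
    obtain rfl : w = fun _ => i := funext h
    exact hm (eq_single_of_const_mem_arrangements hw)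
  refine List.prod_eq_zero (List.mem_ofFn.2 ⟨p, ?_⟩)
  rw [z_single, if_neg hp, map_zero]

theorem e_pow_two_mul {n : ℕ} (i : Fin n) (k : ℕ) : (e i : Cl n) ^ (2 * k) = (-1) ^ k := by
  rw [pow_mul, sq, e_mul_self]

/-- `cos t + sin t eᵢ`. -/
def circ {n : ℕ} (i : Fin n) (t : ℝ) : Cl n := Real.cos t • 1 + Real.sin t • e i

/-- On the axis only `zᵢ` survives, so only `m = k` times the `i`-th unit vector contributes, and
the series becomes that of `exp(t eᵢ)`. -/
theorem E_single {n : ℕ} (i : Fin n) (t : ℝ) :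
    E (EuclideanSpace.single i.succ t) = circ i t := by
  have hk : ∀ k : ℕ, ∑ m ∈ Finset.piAntidiag (Finset.univ : Finset (Fin n)) k,
      fueter m (EuclideanSpace.single i.succ t) * unitSum m = t ^ k • (e i : Cl n) ^ k := fun k => by
    rw [Finset.sum_eq_single (Pi.single i k), fueter_single_mul_unitSum]
    · intro m hm hne
      rw [fueter_single_eq_zero, zero_mul]
      rwa [(Finset.mem_piAntidiag.1 hm).1]
    · intro h
      exact absurd (Finset.mem_piAntidiag.2 ⟨by simp, by simp⟩) h
  simp only [E, hk]
  refine (HasSum.even_add_odd ?_ ?_).tsum_eq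
  · refine ((Real.hasSum_cos t).smul_const (1 : Cl n)).congr_fun fun k => ?_
    rw [e_pow_two_mul, smul_smul]
    have : ((-1 : Cl n)) ^ k = ((-1 : ℝ) ^ k) • 1 := by
      rw [← Algebra.algebraMap_eq_smul_one]; simp
    rw [this, smul_smul]
    congr 1
    ring
  · refine ((Real.hasSum_sin t).smul_const (e i : Cl n)).congr_fun fun k => ?_
    rw [pow_succ (e i), e_pow_two_mul, smul_smul]
    have : ((-1 : Cl n)) ^ k = ((-1 : ℝ) ^ k) • 1 := by
      rw [← Algebra.algebraMap_eq_smul_one]; simp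
    rw [this, smul_mul_assoc, one_mul, smul_smul]
    congr 1
    ring

theorem hasDerivAt_circ {n : ℕ} (i : Fin n) (t : ℝ) :
    HasDerivAt (circ i) (e i * circ i t : Cl n) t := by
  have h := ((Real.hasDerivAt_cos t).smul_const (1 : Cl n)).add
    ((Real.hasDerivAt_sin t).smul_const (e i))
  refine HasDerivAt.congr_deriv (f := circ i) h ?_
  simp only [circ, mul_add, mul_smul_comm, mul_one, e_mul_self, smul_neg, neg_smul]
  abel

/-! ### Moments of exponential sums -/

theorem LeftMonogenic.sub {n : ℕ} {F G : Para n → Cl n} (hF : LeftMonogenic F)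
    (hG : LeftMonogenic G) : LeftMonogenic (F - G) := by
  refine leftMonogenic_of_sum_eq_zero (hF.1.sub hG.1) fun x => ?_
  have : fderiv ℝ (F - G) x = fderiv ℝ F x - fderiv ℝ G x :=
    fderiv_sub (hF.1.differentiable (by simp) x) (hG.1.differentiable (by simp) x)
  simp only [this, _root_.sub_apply, mul_sub, Finset.sum_sub_distrib, hF.sum_eq_zero,
    hG.sum_eq_zero, sub_zero]

/-- A bound of exponential type on `∑ⱼ E(hⱼ x) Zⱼ - E(a x)` controls all its moments. -/
theorem exists_moment_bound {n : ℕ} (i : Fin n) {σ : ℝ} (hσ : 0 ≤ σ) :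
    ∃ C R : ℝ, 0 ≤ C ∧ 0 ≤ R ∧ ∀ (s : Finset ℕ) (h : ℕ → ℝ) (Z : ℕ → Cl n) (a ε : ℝ),
      LeftMonogenic (fun x => ∑ j ∈ s, E (h j • x) * Z j - E (a • x)) →
      (∀ x, ‖∑ j ∈ s, E (h j • x) * Z j - E (a • x)‖ ≤ ε * Real.exp (σ * ‖x‖)) →
      ∀ k : ℕ, ‖∑ j ∈ s, h j ^ k • Z j - a ^ k • (1 : Cl n)‖ ≤ R * ε * C ^ k := by
  set v : Para n := EuclideanSpace.single i.succ 1 with hv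
  obtain ⟨A, hA0, hA⟩ := exists_fderiv_bound n v hσ
  refine ⟨‖mulCLM n‖ * ‖(e i : Cl n)‖ * A, ‖mulCLM n‖ * ‖(1 : Cl n)‖, by positivity, by positivity,
    fun s h Z a ε hF hb k => ?_⟩
  set F : Para n → Cl n := fun x => ∑ j ∈ s, E (h j • x) * Z j - E (a • x) with hFdef
  set D : (Para n → Cl n) → Para n → Cl n := fun G x => fderiv ℝ G x v with hD
  -- The type `σ` is unchanged at each differentiation, so the constants multiply to exactly `A^k`.
  have hiter : ∀ k, LeftMonogenic (D^[k] F) ∧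
      ∀ x, ‖D^[k] F x‖ ≤ A ^ k * ε * Real.exp (σ * ‖x‖) := by
    intro k
    induction k with
    | zero => simpa using ⟨hF, hb⟩
    | succ k ih =>
      rw [Function.iterate_succ_apply']
      refine ⟨ih.1.fderiv_apply v, fun x => (hA _ _ ih.1 ih.2 x).trans (le_of_eq ?_)⟩
      ring
  have hsmul : ∀ r t : ℝ, r • t • v = EuclideanSpace.single i.succ (r * t) := fun r t => by
    rw [hv, smul_smul]; ext j; simp
  have hline : ∀ k t, D^[k] F (t • v) = e i ^ k *
      (∑ j ∈ s, h j ^ k • (circ i (h j * t) * Z j) - a ^ k • circ i (a * t)) := by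
    intro k
    induction k with
    | zero =>
      intro t
      simp [hFdef, hsmul, E_single]
    | succ k ih =>
      intro t
      rw [Function.iterate_succ_apply']
      have hc : ∀ r : ℝ, HasDerivAt (fun t => circ i (r * t)) (r • (e i * circ i (r * t) : Cl n)) t :=
        fun r => by
        have h1 : HasDerivAt (fun t : ℝ => r * t) r t := by
          simpa using (hasDerivAt_id t).const_mul r
        exact (hasDerivAt_circ i (r * t)).scomp t h1
      have h2 : HasDerivAt (fun t => mulCLM n (e i ^ k)
          (∑ j ∈ s, h j ^ k • (mulCLM n).flip (Z j) (circ i (h j * t)) - a ^ k • circ i (a * t)))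
          (mulCLM n (e i ^ k) (∑ j ∈ s, h j ^ k • (mulCLM n).flip (Z j)
            (h j • (e i * circ i (h j * t))) - a ^ k • a • (e i * circ i (a * t)))) t := by
        refine (mulCLM n (e i ^ k)).hasFDerivAt.comp_hasDerivAt t (HasDerivAt.fun_sub
          (HasDerivAt.fun_sum fun j _ => ?_) ((hc a).const_smul (a ^ k)))
        exact (((mulCLM n).flip (Z j)).hasFDerivAt.comp_hasDerivAt t (hc (h j))).const_smul
          (h j ^ k)
      have h3 : HasDerivAt (fun t : ℝ => D^[k] F (t • v)) (D (D^[k] F) (t • v)) t := by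
        have h1 : HasDerivAt (fun t : ℝ => t • v) v t := by
          simpa using (hasDerivAt_id t).smul_const v
        exact ((hiter k).1.1.differentiable (by simp) _).hasFDerivAt.comp_hasDerivAt t h1
      simp only [ih] at h3
      rw [h3.unique h2]
      simp only [mulCLM_apply, ContinuousLinearMap.flip_apply, pow_succ, mul_sub, Finset.mul_sum,
        mul_smul_comm, smul_mul_assoc, smul_smul, mul_assoc]
  have h0 := hline k 0
  have hcirc : (circ i 0 : Cl n) = 1 := by simp [circ]
  simp only [zero_smul, mul_zero, hcirc, one_mul] at h0
  set d : Cl n := ∑ j ∈ s, h j ^ k • Z j - a ^ k • (1 : Cl n) with hd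
  have hbk : ‖e i ^ k * d‖ ≤ A ^ k * ε := by
    rw [← h0]; simpa using (hiter k).2 0
  have hek : ‖(e i : Cl n) ^ k‖ ≤ (‖mulCLM n‖ * ‖(e i : Cl n)‖) ^ k * ‖(1 : Cl n)‖ := by
    have := norm_list_prod_le (norm_nonneg (e i : Cl n)) (f := fun _ : Unit => (e i : Cl n))
      (fun _ => le_rfl) (List.replicate k ())
    simpa using this
  -- The factor `eᵢ^k` is undone by multiplying by it again, since `eᵢ^(2k) = ±1`.
  have hnorm : ‖d‖ = ‖e i ^ k * (e i ^ k * d)‖ := by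
    rw [← mul_assoc, ← pow_add, ← two_mul, e_pow_two_mul]
    rcases neg_one_pow_eq_or (Cl n) k with hk | hk <;> simp [hk]
  rw [hnorm]
  calc _ ≤ ‖mulCLM n‖ * ‖(e i : Cl n) ^ k‖ * ‖e i ^ k * d‖ := norm_mul_le_mulCLM _ _
    _ ≤ ‖mulCLM n‖ * ((‖mulCLM n‖ * ‖(e i : Cl n)‖) ^ k * ‖(1 : Cl n)‖) * (A ^ k * ε) := by gcongr
    _ = _ := by rw [mul_pow _ A]; ring

theorem ConvergesInA1.eventually_bound {n : ℕ} {f : ℕ → Para n → Cl n} {g : Para n → Cl n}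
    (hf : ConvergesInA1 f g) : ∃ σ : ℝ, 0 ≤ σ ∧ ∀ δ > 0, ∀ᶠ N in atTop,
      LeftMonogenic (f N - g) ∧ ∀ x, ‖f N x - g x‖ ≤ δ * Real.exp (σ * ‖x‖) := by
  obtain ⟨σ, hσ, hg, hfN, ht⟩ := hf
  refine ⟨σ, hσ.le, fun δ hδ => ?_⟩
  filter_upwards [ht.eventually (gt_mem_nhds (ENNReal.ofReal_pos.2 hδ))] with N hN
  refine ⟨(hfN N).1.sub hg.1, fun x => ?_⟩
  have h1 : ENNReal.ofReal (‖(f N - g) x‖ * Real.exp (-σ * ‖x‖)) ≤ ENNReal.ofReal δ :=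
    (le_iSup (fun x => ENNReal.ofReal (‖(f N - g) x‖ * Real.exp (-σ * ‖x‖))) x).trans hN.le
  rw [ENNReal.ofReal_le_ofReal_iff hδ.le, neg_mul, Real.exp_neg, ← div_eq_mul_inv,
    div_le_iff₀ (Real.exp_pos _)] at h1
  exact h1

/-! ### Uniform bounds for the power series -/

theorem exists_uniform_tsum_bound {n : ℕ} {u : ℕ → Para n → Para n}
    (hbdd : ∀ (ℓ : ℕ) (K : Set (Para n)), IsCompact K → Bornology.IsBounded (u ℓ '' K))
    (hu : ∀ K : Set (Para n), IsCompact K →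
      limsup (fun ℓ : ℕ => ⨆ x ∈ K, ‖u ℓ x‖ₑ ^ (1 / (ℓ : ℝ))) atTop = 0)
    {K : Set (Para n)} (hK : IsCompact K) {C : ℝ} (hC : 0 ≤ C) :
    ∃ B, ∀ x ∈ K, Summable (fun ℓ => C ^ ℓ * ‖u ℓ x‖) ∧ ∑' ℓ, C ^ ℓ * ‖u ℓ x‖ ≤ B := by
  -- Chosen so that `C r ≤ 1/2`: the tail is dominated by a geometric series, and the finitely many
  -- remaining terms by boundedness on `K`.
  set r : ℝ := 1 / (2 * (C + 1)) with hr
  have hr0 : 0 < r := by positivity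
  have hCr : C * r ≤ 1 / 2 := by
    rw [hr, mul_one_div, div_le_div_iff₀ (by positivity) (by positivity)]
    linarith
  have hlt := eventually_lt_of_limsup_lt ((hu K hK).trans_lt (ENNReal.ofReal_pos.2 hr0))
  -- The index `ℓ = 0` must be excluded, since there `1 / ℓ` takes the default value 0 and the root
  -- cannot be inverted.
  obtain ⟨L, hL⟩ := eventually_atTop.1 (hlt.and (eventually_ge_atTop 1))
  have htail : ∀ ℓ ≥ L, ∀ x ∈ K, ‖u ℓ x‖ ≤ r ^ ℓ := fun ℓ hℓ x hx => by
    obtain ⟨h1, h2⟩ := hL ℓ hℓ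
    have h3 : ‖u ℓ x‖ₑ ^ (1 / (ℓ : ℝ)) ≤ ENNReal.ofReal r :=
      (le_iSup₂ (f := fun x (_ : x ∈ K) => ‖u ℓ x‖ₑ ^ (1 / (ℓ : ℝ))) x hx).trans h1.le
    rw [one_div, ENNReal.rpow_inv_le_iff (by positivity), ENNReal.rpow_natCast,
      ← ENNReal.ofReal_pow hr0.le, ← ofReal_norm,
      ENNReal.ofReal_le_ofReal_iff (by positivity)] at h3
    exact h3
  have hhead : ∀ ℓ, ∃ b, 0 ≤ b ∧ ∀ x ∈ K, ‖u ℓ x‖ ≤ b := fun ℓ => by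
    obtain ⟨b, hb⟩ := (hbdd ℓ K hK).exists_norm_le
    exact ⟨|b|, abs_nonneg b, fun x hx => (hb _ ⟨x, hx, rfl⟩).trans (le_abs_self b)⟩
  choose b hb0 hb using hhead
  set q : ℕ → ℝ := fun ℓ => (1 / 2) ^ ℓ + if ℓ ∈ Finset.range L then C ^ ℓ * b ℓ else 0 with hq
  have hqs : Summable q := (summable_geometric_of_lt_one (by norm_num) (by norm_num)).add
    (summable_of_ne_finset_zero (s := Finset.range L) fun ℓ hℓ => if_neg hℓ)
  have hle : ∀ x ∈ K, ∀ ℓ, C ^ ℓ * ‖u ℓ x‖ ≤ q ℓ := fun x hx ℓ => by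
    by_cases hℓ : ℓ ∈ Finset.range L
    · simp only [hq, if_pos hℓ]
      have : C ^ ℓ * ‖u ℓ x‖ ≤ C ^ ℓ * b ℓ := by gcongr; exact hb ℓ x hx
      have h2 : (0 : ℝ) ≤ (1 / 2) ^ ℓ := by positivity
      linarith
    · simp only [hq, if_neg hℓ, add_zero]
      rw [Finset.mem_range, not_lt] at hℓ
      calc C ^ ℓ * ‖u ℓ x‖ ≤ C ^ ℓ * r ^ ℓ := by gcongr; exact htail ℓ hℓ x hx
        _ = (C * r) ^ ℓ := (mul_pow _ _ _).symm
        _ ≤ _ := by gcongr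
  refine ⟨∑' ℓ, q ℓ, fun x hx => ?_⟩
  have hs : Summable fun ℓ => C ^ ℓ * ‖u ℓ x‖ :=
    Summable.of_nonneg_of_le (fun ℓ => by positivity) (hle x hx) hqs
  exact ⟨hs, hs.tsum_le_tsum (hle x hx) hqs⟩

theorem E_eq_one (x : Para 0) : E x = 1 := by
  have h0 : Finset.piAntidiag (Finset.univ : Finset (Fin 0)) 0 = {0} := by simp
  rw [E, tsum_eq_single 0, h0]
  · have : (arrangements (0 : Fin 0 → ℕ)) = {fun p => p.elim0} := by
      ext w
      simp [arrangements, eq_iff_true_of_subsingleton]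
    rw [Finset.sum_singleton, fueter, unitSum, this, Finset.sum_singleton, Finset.sum_singleton]
    simp
  · intro k hk
    have : Finset.piAntidiag (Finset.univ : Finset (Fin 0)) k = ∅ := by
      ext m; simp [hk.symm]
    rw [this, Finset.sum_empty, smul_zero]

end

end Monogenic

theorem mainTheorem10 (n : ℕ) (u : ℕ → Monogenic.Para n → Monogenic.Para n)
    (hbdd : ∀ (ℓ : ℕ) (K : Set (Monogenic.Para n)), IsCompact K →
      Bornology.IsBounded (u ℓ '' K))
    (hu : ∀ K : Set (Monogenic.Para n), IsCompact K →
      limsup (fun ℓ : ℕ => ⨆ x ∈ K, ‖u ℓ x‖ₑ ^ (1 / (ℓ : ℝ))) atTop = 0)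
    (a : ℝ) (h : ℕ → ℕ → ℝ) (Z : ℕ → ℕ → Monogenic.Cl n)
    (hh : ∀ N j, j ≤ N → h N j ∈ Set.Icc (-1 : ℝ) 1)
    (hf : Monogenic.ConvergesInA1
      (fun N x => ∑ j ∈ Finset.range (N + 1), Monogenic.E (h N j • x) * Z N j)
      (fun x => Monogenic.E (a • x))) :
    (∀ (x : Monogenic.Para n) (t : ℝ), Summable fun ℓ : ℕ => t ^ ℓ • u ℓ x) ∧
    ∀ K : Set (Monogenic.Para n), IsCompact K →
      TendstoUniformlyOn
        (fun N x => ∑ j ∈ Finset.range (N + 1),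
          Z N j * Monogenic.E (∑' ℓ : ℕ, h N j ^ ℓ • u ℓ x))
        (fun x => Monogenic.E (∑' ℓ : ℕ, a ^ ℓ • u ℓ x)) atTop K := by
  refine ⟨fun x t => ?_, fun K hK => ?_⟩
  · obtain ⟨B, hB⟩ := Monogenic.exists_uniform_tsum_bound hbdd hu
      (isCompact_singleton (x := x)) (abs_nonneg t)
    exact Summable.of_norm_bounded (hB x rfl).1 fun ℓ => Monogenic.norm_pow_smul_le le_rfl ℓ _
  obtain ⟨σ, hσ, hev⟩ := hf.eventually_bound
  rw [Metric.tendstoUniformlyOn_iff]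
  intro ε hε
  -- Without imaginary units there is no axis to differentiate along; but then `E` is identically 1,
  -- and the hypothesis at the origin is already the claim.
  rcases n with _ | n
  · filter_upwards [hev (ε / 2) (by positivity)] with N hN x _
    have := hN.2 0
    simp only [Monogenic.E_eq_one, one_mul, norm_zero, mul_zero, Real.exp_zero, mul_one] at this ⊢
    rw [dist_comm, dist_eq_norm]
    linarith
  obtain ⟨C₀, R, hC₀, hR, hmom⟩ := Monogenic.exists_moment_bound (0 : Fin (n + 1)) hσ
  -- The radius must exceed the growth rate of the moment errors and contain all nodes `hⱼ` and the
  -- point `a`.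
  set C : ℝ := max C₀ (max 1 |a|) with hCdef
  have hC : 0 ≤ C := hC₀.trans (le_max_left _ _)
  obtain ⟨B, hB⟩ := Monogenic.exists_uniform_tsum_bound hbdd hu hK hC
  obtain ⟨M, hM⟩ := Monogenic.PowBound.exists_E (n + 1) (B := B) hC
  set P : ℝ := ‖Monogenic.mulCLM (n + 1)‖ * R * |M| with hP
  have hP0 : 0 ≤ P := by positivity
  set δ : ℝ := ε / (P + 1) with hδ
  have hδ0 : 0 < δ := by positivity
  filter_upwards [hev δ hδ0] with N hN x hx
  have hU : Monogenic.PowBound C (fun t => ∑' ℓ : ℕ, t ^ ℓ • u ℓ x) B :=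
    ⟨ℕ, fun ℓ => ℓ, fun ℓ => u ℓ x, (hB x hx).1, (hB x hx).2, fun t ht =>
      (Summable.of_norm_bounded (hB x hx).1 fun ℓ =>
        Monogenic.norm_pow_smul_le ht ℓ (u ℓ x)).hasSum⟩
  have hd : ∀ k : ℕ, ‖∑ j ∈ Finset.range (N + 1), h N j ^ k • Z N j -
      a ^ k • (1 : Monogenic.Cl (n + 1))‖ ≤ (R * δ) * C ^ k := fun k =>
    (hmom _ (h N) (Z N) a δ hN.1 hN.2 k).trans (by gcongr; exact le_max_left _ _)
  have hfin := (hM _ hU).norm_functional_le ((le_max_right _ _).trans (le_max_right _ _))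
    (Finset.range (N + 1)) (h N) (fun j hj => (abs_le.2 (hh N j (Nat.lt_succ_iff.1
      (Finset.mem_range.1 hj)))).trans ((le_max_left _ _).trans (le_max_right _ _)))
    (Z N) (by positivity) hd
  rw [dist_comm, dist_eq_norm]
  refine hfin.trans_lt ?_
  calc ‖Monogenic.mulCLM (n + 1)‖ * (R * δ) * M
      ≤ ‖Monogenic.mulCLM (n + 1)‖ * (R * δ) * |M| := by gcongr; exact le_abs_self M
    _ = P * δ := by rw [hP]; ring
    _ < (P + 1) * δ := by gcongr; linarith
    _ = ε := by rw [hδ]; field_simp
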